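/- Throughout, graphs are finite and simple. Let $\mathcal{Q}$ be the rectangular grid, i.e. the graph on $\mathbb{Z}\times\mathbb{Z}$ in which two points are adjacent when they agree in one coordinate and differ by exactly $1$ in the other. An EPG representation of a graph $G$ assigns to every vertex $v$ of $G$ a path $P_v$ of $\mathcal{Q}$ with at least one edge, such that two distinct vertices $u,v$ are adjacent in $G$ if and only if $P_u$ and $P_v$ share an edge of $\mathcal{Q}$. A bend of a path is a pair of consecutive edges, one horizontal and the other vertical. The representation is $B_1$-EPG if every path $P_v$ has at most one bend, and it is Helly if the family $(E(P_v))_{v\in V(G)}$ of edge sets of the paths has the Helly property: for every $S\subseteq V(G)$ such that the paths $P_v$, $v\in S$, pairwise share an edge, there is an edge of $\mathcal{Q}$ that lies on all paths $P_v$, $v\in S$. A graph is Helly-$B_1$-EPG if it has a representation that is both $B_1$-EPG and Helly. The line graph $L(H)$ of a graph $H$ has the edges of $H$ as its vertices, two distinct edges being adjacent in $L(H)$ if and only if they have a common endpoint in $H$. **Corollary.** Every line graph of a bipartite graph is Helly-$B_1$-EPG; that is, if $H$ is a bipartite graph and $G\cong L(H)$, then $G$ is a Helly-$B_1$-EPG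 graph. -/

import Mathlib

namespace EPG

/-- The (infinite rectangular) grid: points of `ℤ × ℤ`, two points being joined by an edge when
they agree in one coordinate and are consecutive integers in the other. -/
noncomputable abbrev grid : SimpleGraph (ℤ × ℤ) :=
  (SimpleGraph.hasse ℤ) □ (SimpleGraph.hasse ℤ)

/-- A (directed) edge of the grid is horizontal if its two ends lie on the same row. -/
def IsHorizontal (d : grid.Dart) : Prop := d.fst.2 = d.snd.2

noncomputable instance (d : grid.Dart) : Decidable (IsHorizontal d) :=
  inferInstanceAs (Decidable (d.fst.2 = d.snd.2))

/-- The number of bends of a walk in the grid: the number of pairs of consecutive edges of which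
one is horizontal and the other one vertical. -/
noncomputable def numBends {a b : ℤ × ℤ} (p : grid.Walk a b) : ℕ :=
  (p.darts.zip p.darts.tail).countP
    (fun dd => decide (¬ (IsHorizontal dd.1 ↔ IsHorizontal dd.2)))

/-- An EPG representation of `G`: each vertex is assigned a path of the grid with at least one
edge, and two distinct vertices are adjacent exactly when their paths share an edge of the grid. -/
structure Representation {V : Type*} (G : SimpleGraph V) where
  source : V → ℤ × ℤ
  target : V → ℤ × ℤ
  path : ∀ v, grid.Walk (source v) (target v)
  isPath : ∀ v, (path v).IsPath
  not_nil : ∀ v, ¬ (path v).Nil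
  adj_iff : ∀ u v, u ≠ v → (G.Adj u v ↔ ∃ e, e ∈ (path u).edges ∧ e ∈ (path v).edges)

/-- The Helly property of a family of sets: every pairwise intersecting subfamily has a common
element. -/
def HellyProperty {ι α : Type*} (F : ι → Set α) : Prop :=
  ∀ S : Set ι, (∀ i ∈ S, ∀ j ∈ S, (F i ∩ F j).Nonempty) → ∃ x, ∀ i ∈ S, x ∈ F i

namespace Representation

variable {V : Type*} {G : SimpleGraph V}

/-- The set of grid edges of the path representing `v`. -/
def edgeSet (R : Representation G) (v : V) : Set (Sym2 (ℤ × ℤ)) :=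
  {e | e ∈ (R.path v).edges}

/-- A `B_k`-EPG representation: every path has at most `k` bends. -/
def IsB (R : Representation G) (k : ℕ) : Prop := ∀ v, numBends (R.path v) ≤ k

/-- A Helly representation: the edge sets of its paths have the Helly property. -/
def IsHelly (R : Representation G) : Prop := HellyProperty R.edgeSet

end Representation

/-- `G` is a Helly-`B_k`-EPG graph: a single representation is both `B_k`-EPG and Helly. -/
def IsHellyB {V : Type*} (k : ℕ) (G : SimpleGraph V) : Prop :=
  ∃ R : Representation G, R.IsB k ∧ R.IsHelly

end EPG

namespace EPG

/-! An edge of a bipartite graph is a pair (end of colour 0, end of colour 1), and distinct edges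
meet exactly when their pairs agree in a coordinate. Number the ends by `f` and `g`, and send each
edge to the corner path along row `f + 1` from column 0, then down column `g + 1` to row 0. Paths on
the same row share its leftmost edge, paths on the same column share its lowest edge, and no other
pairs share an edge. For Helly, pairs that pairwise agree somewhere are all constant in one fixed
coordinate, so that row's or column's end edge is common. -/

/-- A list that splits into a part where `P` holds followed by a part where it fails has at most
one pair of consecutive entries on which `P` changes. -/
lemma countP_change_append_le_one {α : Type*} (P : α → Prop) [DecidablePred P] :
    ∀ l₁ l₂ : List α, (∀ a ∈ l₁, P a) → (∀ a ∈ l₂, ¬ P a) →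
      ((l₁ ++ l₂).zip (l₁ ++ l₂).tail).countP
        (fun c => decide (¬ (P c.1 ↔ P c.2))) ≤ 1 := by
  have const : ∀ l : List α, (∀ a ∈ l, ¬ P a) →
      (l.zip l.tail).countP (fun c => decide (¬ (P c.1 ↔ P c.2))) = 0 := by
    intro l hl
    rw [List.countP_eq_zero]
    rintro ⟨a, b⟩ hab
    have ha := hl a (List.of_mem_zip hab).1
    have hb := hl b (List.mem_of_mem_tail (List.of_mem_zip hab).2)
    simp [ha, hb]
  intro l₁ l₂ h₁ h₂
  induction l₁ with
  | nil => simpa using (const l₂ h₂).le.trans zero_le_one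
  | cons a l ih =>
    have ih := ih fun b hb => h₁ b (List.mem_cons_of_mem a hb)
    have ha : P a := h₁ a List.mem_cons_self
    cases l with
    | nil =>
      cases l₂ with
      | nil => simp
      | cons b l' =>
        -- At the junction only the pair `(a, b)` can count.
        have hc := const (b :: l') h₂
        simp only [List.tail_cons] at hc
        simp only [List.cons_append, List.nil_append, List.tail_cons, List.zip_cons_cons,
          List.countP_cons, hc]
        split <;> simp
    | cons b l' =>
      have hb : P b := h₁ b (by simp)
      simp only [List.cons_append, List.tail_cons, List.zip_cons_cons, List.countP_cons] at ih ⊢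
      simpa [ha, hb] using ih

/-- A walk along which an integer potential strictly increases is a path. -/
lemma isPath_of_forall_darts_lt {V : Type*} {G : SimpleGraph V} (φ : V → ℤ) {a b : V}
    (p : G.Walk a b) (h : ∀ d ∈ p.darts, φ d.fst < φ d.snd) : p.IsPath := by
  -- The start must also minimise `φ` on the support, so that a vertex prepended with a smaller
  -- value is new.
  suffices p.IsPath ∧ ∀ v ∈ p.support, φ a ≤ φ v from this.1
  induction p with
  | nil => simp
  | cons hadj q ih =>
    simp only [SimpleGraph.Walk.darts_cons, List.mem_cons, forall_eq_or_imp] at h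
    obtain ⟨hq, hle⟩ := ih h.2
    refine ⟨hq.cons fun hmem => (hle _ hmem).not_gt h.1, ?_⟩
    simp only [SimpleGraph.Walk.support_cons, List.mem_cons, forall_eq_or_imp, le_refl, true_and]
    exact fun v hv => h.1.le.trans (hle v hv)

lemma grid_adj_right (x y : ℤ) : grid.Adj (x, y) (x + 1, y) := by
  simp [SimpleGraph.boxProd_adj]

lemma grid_adj_down (x y : ℤ) : grid.Adj (x, y + 1) (x, y) := by
  simp [SimpleGraph.boxProd_adj]

/-- Darts rather than edges are described: the path criterion needs their direction, and bends are
counted on darts. -/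
lemma exists_horizontal_walk (y : ℤ) (n : ℕ) :
    ∃ p : grid.Walk (0, y) ((n : ℤ), y), ∀ d : grid.Dart,
      d ∈ p.darts ↔ ∃ t : ℤ, (0 ≤ t ∧ t < n) ∧ d.toProd = ((t, y), (t + 1, y)) := by
  induction n with
  | zero =>
    refine ⟨SimpleGraph.Walk.nil, fun d => ?_⟩
    simp only [SimpleGraph.Walk.darts_nil, List.not_mem_nil, false_iff]
    rintro ⟨t, ⟨h₀, h₁⟩, -⟩
    simp only [Nat.cast_zero] at h₁
    omega
  | succ n ih =>
    obtain ⟨p, hp⟩ := ih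
    refine ⟨(p.concat (grid_adj_right n y)).copy rfl (by push_cast; rfl), fun d => ?_⟩
    simp only [SimpleGraph.Walk.darts_copy, SimpleGraph.Walk.darts_concat, List.concat_eq_append,
      List.mem_append, List.mem_singleton, hp]
    constructor
    · rintro (⟨t, ht, hd⟩ | rfl)
      · exact ⟨t, by push_cast; omega, hd⟩
      · exact ⟨n, by push_cast; omega, rfl⟩
    · rintro ⟨t, ht, hd⟩
      push_cast at ht
      obtain h | rfl : t < n ∨ t = n := by omega
      · exact Or.inl ⟨t, ⟨ht.1, h⟩, hd⟩
      · exact Or.inr (SimpleGraph.Dart.ext _ _ hd)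

lemma exists_vertical_walk (x : ℤ) (n : ℕ) :
    ∃ p : grid.Walk (x, (n : ℤ)) (x, 0), ∀ d : grid.Dart,
      d ∈ p.darts ↔ ∃ t : ℤ, (0 ≤ t ∧ t < n) ∧ d.toProd = ((x, t + 1), (x, t)) := by
  induction n with
  | zero =>
    refine ⟨SimpleGraph.Walk.nil, fun d => ?_⟩
    simp only [SimpleGraph.Walk.darts_nil, List.not_mem_nil, false_iff]
    rintro ⟨t, ⟨h₀, h₁⟩, -⟩
    simp only [Nat.cast_zero] at h₁
    omega
  | succ n ih =>
    obtain ⟨p, hp⟩ := ih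
    refine ⟨(SimpleGraph.Walk.cons (grid_adj_down x n) p).copy (by push_cast; rfl) rfl,
      fun d => ?_⟩
    simp only [SimpleGraph.Walk.darts_copy, SimpleGraph.Walk.darts_cons, List.mem_cons, hp]
    constructor
    · rintro (rfl | ⟨t, ht, hd⟩)
      · exact ⟨n, by push_cast; omega, rfl⟩
      · exact ⟨t, by push_cast; omega, hd⟩
    · rintro ⟨t, ht, hd⟩
      push_cast at ht
      obtain h | rfl : t < n ∨ t = n := by omega
      · exact Or.inr ⟨t, ⟨ht.1, h⟩, hd⟩
      · exact Or.inl (SimpleGraph.Dart.ext _ _ hd)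

/-- The horizontal grid edge whose left end is `(t, y)`. -/
abbrev horizontalEdge (t y : ℤ) : Sym2 (ℤ × ℤ) := s((t, y), (t + 1, y))

/-- The vertical grid edge whose lower end is `(x, t)`. -/
abbrev verticalEdge (x t : ℤ) : Sym2 (ℤ × ℤ) := s((x, t + 1), (x, t))

/-- There is a one-bend path running along row `n` from column `0` to column `m`, and then down
column `m` to row `0`. -/
lemma exists_corner_path (m n : ℕ) :
    ∃ p : grid.Walk (0, (n : ℤ)) ((m : ℤ), 0), p.IsPath ∧ numBends p ≤ 1 ∧
      ∀ e, e ∈ p.edges ↔ (∃ t : ℤ, (0 ≤ t ∧ t < m) ∧ e = horizontalEdge t n) ∨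
        ∃ t : ℤ, (0 ≤ t ∧ t < n) ∧ e = verticalEdge m t := by
  obtain ⟨p, hp⟩ := exists_horizontal_walk n m
  obtain ⟨q, hq⟩ := exists_vertical_walk m n
  refine ⟨p.append q, ?_, ?_, fun e => ?_⟩
  -- Column minus row grows by 1 on each step right and on each step down.
  · apply isPath_of_forall_darts_lt fun z => z.1 - z.2
    intro d hd
    rw [SimpleGraph.Walk.darts_append, List.mem_append, hp, hq] at hd
    obtain ⟨t, -, hd⟩ | ⟨t, -, hd⟩ := hd <;> simp [hd]
  · rw [numBends, SimpleGraph.Walk.darts_append]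
    apply countP_change_append_le_one IsHorizontal
    · intro d hd
      obtain ⟨t, -, hd⟩ := (hp d).1 hd
      simp [IsHorizontal, hd]
    · intro d hd
      obtain ⟨t, -, hd⟩ := (hq d).1 hd
      simp [IsHorizontal, hd]
  · simp only [SimpleGraph.Walk.edges, SimpleGraph.Walk.darts_append, List.map_append,
      List.mem_append, List.mem_map, hp, hq]
    refine or_congr ⟨?_, ?_⟩ ⟨?_, ?_⟩
    · rintro ⟨d, ⟨t, ht, hd⟩, rfl⟩
      exact ⟨t, ht, by simp [SimpleGraph.Dart.edge, hd]⟩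
    · rintro ⟨t, ht, rfl⟩
      exact ⟨⟨_, grid_adj_right t n⟩, ⟨t, ht, rfl⟩, rfl⟩
    · rintro ⟨d, ⟨t, ht, hd⟩, rfl⟩
      exact ⟨t, ht, by simp [SimpleGraph.Dart.edge, hd]⟩
    · rintro ⟨t, ht, rfl⟩
      exact ⟨⟨_, grid_adj_down m t⟩, ⟨t, ht, rfl⟩, rfl⟩

lemma horizontalEdge_ne_verticalEdge (t y x s : ℤ) : horizontalEdge t y ≠ verticalEdge x s := by
  simp only [ne_eq, Sym2.eq_iff, Prod.mk.injEq]
  omega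

lemma row_eq_of_horizontalEdge_eq {t y t' y' : ℤ} (h : horizontalEdge t y = horizontalEdge t' y') :
    y = y' := by
  simp only [Sym2.eq_iff, Prod.mk.injEq] at h
  omega

lemma column_eq_of_verticalEdge_eq {x t x' t' : ℤ} (h : verticalEdge x t = verticalEdge x' t') :
    x = x' := by
  simp only [Sym2.eq_iff, Prod.mk.injEq] at h
  omega

/-- A family of pairs, any two of which agree in some coordinate, is constant in one of the
coordinates. -/
lemma forall_fst_eq_or_forall_snd_eq {V : Type*} {f g : V → ℕ} {S : Set V}
    (h : ∀ u ∈ S, ∀ v ∈ S, f u = f v ∨ g u = g v) :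
    (∀ u ∈ S, ∀ v ∈ S, f u = f v) ∨ (∀ u ∈ S, ∀ v ∈ S, g u = g v) := by
  -- If `f` separates `u` and `v`, they agree in `g`. No third element matches both in `f`, so `w`
  -- and `z` take that same `g` value.
  by_contra! hc
  obtain ⟨⟨u, hu, v, hv, huv⟩, w, hw, z, hz, hwz⟩ := hc
  have := h u hu v hv
  have := h u hu w hw
  have := h v hv w hw
  have := h u hu z hz
  have := h v hv z hz
  omega

/-- A graph whose adjacency means agreement in one of two coordinates is Helly-`B₁`-EPG. -/
theorem isHellyB_one_of_adj_iff {V : Type*} {G : SimpleGraph V} (f g : V → ℕ)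
    (hG : ∀ u v, u ≠ v → (G.Adj u v ↔ f u = f v ∨ g u = g v)) : IsHellyB 1 G := by
  -- The shift by 1 makes both arms nonempty even for label 0.
  choose p hpath hbend hedge using fun v => exists_corner_path (g v + 1) (f v + 1)
  have hrow : ∀ v, horizontalEdge 0 (f v + 1 : ℕ) ∈ (p v).edges := fun v =>
    (hedge v _).2 (Or.inl ⟨0, ⟨le_rfl, by positivity⟩, rfl⟩)
  have hcol : ∀ v, verticalEdge (g v + 1 : ℕ) 0 ∈ (p v).edges := fun v =>
    (hedge v _).2 (Or.inr ⟨0, ⟨le_rfl, by positivity⟩, rfl⟩)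
  have key : ∀ u v, (∃ e, e ∈ (p u).edges ∧ e ∈ (p v).edges) ↔ f u = f v ∨ g u = g v := by
    intro u v
    constructor
    · rintro ⟨e, hu, hv⟩
      rw [hedge] at hu hv
      obtain ⟨t, -, rfl⟩ | ⟨t, -, rfl⟩ := hu <;> obtain ⟨s, -, hs⟩ | ⟨s, -, hs⟩ := hv
      · have := row_eq_of_horizontalEdge_eq hs
        left; omega
      · exact absurd hs (horizontalEdge_ne_verticalEdge _ _ _ _)
      · exact absurd hs.symm (horizontalEdge_ne_verticalEdge _ _ _ _)
      · have := column_eq_of_verticalEdge_eq hs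
        right; omega
    · rintro (h | h)
      · exact ⟨_, hrow u, by rw [h]; exact hrow v⟩
      · exact ⟨_, hcol u, by rw [h]; exact hcol v⟩
  refine ⟨⟨_, _, p, hpath, fun v hnil => ?_, fun u v huv => (hG u v huv).trans (key u v).symm⟩,
    hbend, fun S hS => ?_⟩
  · have := congrArg Prod.fst hnil.eq
    simp only at this
    omega
  · have hS' : ∀ u ∈ S, ∀ v ∈ S, f u = f v ∨ g u = g v := fun u hu v hv =>
      (key u v).1 (hS u hu v hv)
    obtain rfl | ⟨w, hw⟩ := S.eq_empty_or_nonempty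
    -- For empty `S` any edge will do.
    · exact ⟨horizontalEdge 0 0, by simp⟩
    obtain h | h := forall_fst_eq_or_forall_snd_eq hS'
    · exact ⟨horizontalEdge 0 (f w + 1 : ℕ), fun v hv => h v hv w hw ▸ hrow v⟩
    · exact ⟨verticalEdge (g w + 1 : ℕ) 0, fun v hv => h v hv w hw ▸ hcol v⟩

/-- In a properly 2-coloured graph every edge has exactly one end of each colour. -/
lemma exists_unique_end {W : Type*} {H : SimpleGraph W} (C : H.Coloring (Fin 2)) (c : Fin 2)
    (e : H.edgeSet) : ∃ w, ∀ x, (x ∈ (e : Sym2 W) ∧ C x = c) ↔ x = w := by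
  obtain ⟨e, he⟩ := e
  induction e using Sym2.ind with
  | _ a b =>
    have hab : C a ≠ C b := C.valid he
    obtain h | h : C a = c ∨ C b = c := by omega
    · refine ⟨a, fun x => ⟨?_, ?_⟩⟩
      · rintro ⟨hx, hc⟩
        obtain rfl | rfl := Sym2.mem_iff.1 hx
        · rfl
        · exact absurd (h.trans hc.symm) hab
      · rintro rfl
        exact ⟨Sym2.mem_mk_left _ _, h⟩
    · refine ⟨b, fun x => ⟨?_, ?_⟩⟩
      · rintro ⟨hx, hc⟩
        obtain rfl | rfl := Sym2.mem_iff.1 hx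
        · exact absurd (hc.trans h.symm) hab
        · rfl
      · rintro rfl
        exact ⟨Sym2.mem_mk_right _ _, h⟩

/-- The values of a function on a finite type can be relabelled injectively by natural numbers. -/
lemma exists_nat_labelling {V W : Type*} [Finite V] (α : V → W) :
    ∃ f : V → ℕ, ∀ u v, f u = f v ↔ α u = α v := by
  -- `W` may be uncountable, but the range of `α` is finite.
  obtain ⟨i, hi⟩ := exists_injective_nat (Set.range α)
  exact ⟨fun v => i ⟨α v, v, rfl⟩, fun u v => hi.eq_iff.trans Subtype.mk_eq_mk⟩

end EPG

theorem mainTheorem7 {V W : Type*} [Finite V] (G : SimpleGraph V) (H : SimpleGraph W)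
    (hH : H.IsBipartite) (hG : Nonempty (G ≃g H.lineGraph)) :
    EPG.IsHellyB 1 G := by
  obtain ⟨φ⟩ := hG
  obtain ⟨C⟩ := hH
  -- `α c v` is the end of colour `c` of the edge `φ v`.
  choose α hα using fun (c : Fin 2) (v : V) => EPG.exists_unique_end C c (φ v)
  have hmem : ∀ c v, α c v ∈ (φ v : Sym2 W) ∧ C (α c v) = c := fun c v => (hα c v _).2 rfl
  obtain ⟨f, hf⟩ := EPG.exists_nat_labelling (α 0)
  obtain ⟨g, hg⟩ := EPG.exists_nat_labelling (α 1)
  refine EPG.isHellyB_one_of_adj_iff f g fun u v huv => ?_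
  rw [← φ.map_adj_iff, SimpleGraph.lineGraph_adj_iff_exists, hf, hg]
  constructor
  · rintro ⟨-, x, hu, hv⟩
    -- The shared end `x` is, for both edges, their unique end of its colour.
    obtain h | h : C x = 0 ∨ C x = 1 := by omega
    · exact Or.inl (((hα 0 u x).1 ⟨hu, h⟩).symm.trans ((hα 0 v x).1 ⟨hv, h⟩))
    · exact Or.inr (((hα 1 u x).1 ⟨hu, h⟩).symm.trans ((hα 1 v x).1 ⟨hv, h⟩))
  · rintro (h | h)
    · exact ⟨φ.injective.ne huv, α 0 u, (hmem 0 u).1, h ▸ (hmem 0 v).1⟩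
    · exact ⟨φ.injective.ne huv, α 1 u, (hmem 1 u).1, h ▸ (hmem 1 v).1⟩
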